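/- Let $\mathbb{F}=\mathbb{F}_2$, let $\mathscr{V}^f$ be the category of finite-dimensional $\mathbb{F}$-vector spaces, and let $\mathscr{FA}$ be the category of functors from $\mathscr{V}^f$ to abelian groups; $V^\sharp$ denotes the dual of the vector space $V$. For $V\in\mathscr{V}^f$ let $\overline{P}_{\mathbb{Z}}(V)\subset \mathbb{Z}[V]$ be the augmentation ideal of the integral group ring of $V$, and $\overline{P}_{\mathbb{Z}}^{n}(V)$ (for $n\ge 1$) its $n$-th power. Put $R^n_{\mathbb{Z}}:=\overline{P}_{\mathbb{Z}}/\overline{P}_{\mathbb{Z}}^{n+1}\in\mathscr{FA}$. Since $2\,\overline{P}_{\mathbb{Z}}^{n+1}\subset\overline{P}_{\mathbb{Z}}^{n+2}$, multiplication by $2$ on $\overline{P}_{\mathbb{Z}}$ induces morphisms $R^n_{\mathbb{Z}}\to R^{n+1}_{\mathbb{Z}}$; let $R^\infty_{\mathbb{Z}}$ be the direct limit of $R^1_{\mathbb{Z}}\to R^2_{\mathbb{Z}}\to R^3_{\mathbb{Z}}\to\cdots$ in $\mathscr{FA}$. Let $\overline{P}_{\mathbb{Z}_2}:=\mathbb{Z}_2\otimes\overline{P}_{\mathbb{Z}}$,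 where $\mathbb{Z}_2$ is the ring of $2$-adic integers; each group $\overline{P}_{\mathbb{Z}_2}(V)$ is given its $2$-adic topology. For a functor $F$ from $\mathscr{V}^f$ to topological abelian groups let $DF\in\mathscr{FA}$ be its Pontrjagin dual $$DF(V):=\mathrm{Hom}_{\mathrm{cts}}\bigl(F(V^\sharp),\mathbb{Z}/2^\infty\bigr),$$ the group of continuous homomorphisms to the discrete Prüfer group $\mathbb{Z}/2^\infty$. A functor $F\in\mathscr{FA}$ that carries no given topology is regarded as taking values in discrete groups, so that $DF(V)=\mathrm{Hom}(F(V^\sharp),\mathbb{Z}/2^\infty)$. **Theorem.** There are isomorphisms in $\mathscr{FA}$ (that is, isomorphisms natural in $V$) $$R^\infty_{\mathbb{Z}}\cong D\overline{P}_{\mathbb{Z}_2},\qquad \overline{P}_{\mathbb{Z}_2}\cong D R^\infty_{\mathbb{Z}}.$$ -/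

import Mathlib

open CategoryTheory Opposite

noncomputable section

namespace ElemAb

/-! ### Functors on elementary abelian 2-groups -/

/-- The category of finite-dimensional vector spaces over the field with two elements. -/
abbrev Vf : Type 1 := FGModuleCat.{0} (ZMod 2)

/-- Functors from finite-dimensional `𝔽₂`-vector spaces to abelian groups. -/
abbrev FA : Type 1 := Vf ⥤ AddCommGrpCat.{0}

/-- Topological abelian groups. -/
abbrev TopAb : Type 1 := TopModuleCat.{0} ℤ

/-- Functors from finite-dimensional `𝔽₂`-vector spaces to topological abelian groups. -/
abbrev TopFA : Type 1 := Vf ⥤ TopAb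

/-- Vector space duality `V ↦ V^♯`. -/
def sharp : Vfᵒᵖ ⥤ Vf where
  obj V := FGModuleCat.of (ZMod 2) (Module.Dual (ZMod 2) V.unop)
  map f := FGModuleCat.ofHom f.unop.hom.hom.dualMap

/-! ### Pontrjagin duality -/

/-- The Prüfer group `ℤ/2^∞`, as `ℚ₂/ℤ₂`. -/
def Prufer : Type := ℚ_[2] ⧸ (PadicInt.subring 2).toAddSubgroup

instance : AddCommGroup Prufer :=
  inferInstanceAs (AddCommGroup (ℚ_[2] ⧸ (PadicInt.subring 2).toAddSubgroup))

/-- The Prüfer group is a discrete group. -/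
instance : TopologicalSpace Prufer := ⊥

instance : DiscreteTopology Prufer := ⟨rfl⟩

/-- The functor `A ↦ Hom(A, ℤ/2^∞)` on abelian groups. -/
def homPrufer : AddCommGrpCat.{0}ᵒᵖ ⥤ AddCommGrpCat.{0} where
  obj A := AddCommGrpCat.of (A.unop →+ Prufer)
  map f := AddCommGrpCat.ofHom
    { toFun := fun φ => φ.comp f.unop.hom
      map_zero' := rfl
      map_add' := fun _ _ => rfl }

/-- The functor `A ↦ Hom_cts(A, ℤ/2^∞)` on topological abelian groups. -/
def contHomPrufer : TopAbᵒᵖ ⥤ AddCommGrpCat.{0} where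
  obj A := AddCommGrpCat.of (A.unop →ₜ+ Prufer)
  map f := AddCommGrpCat.ofHom
    { toFun := fun φ =>
        { toAddMonoidHom := φ.toAddMonoidHom.comp f.unop.hom.toLinearMap.toAddMonoidHom
          continuous_toFun := φ.continuous_toFun.comp f.unop.hom.continuous }
      map_zero' := rfl
      map_add' := fun _ _ => rfl }

/-- The duality functor on functors with values in (discrete) abelian groups:
`(D F)(V) = Hom(F(V^♯), ℤ/2^∞)`. -/
def D : FAᵒᵖ ⥤ FA where
  obj F := sharp.rightOp ⋙ F.unop.op ⋙ homPrufer
  map η := Functor.whiskerLeft sharp.rightOp (Functor.whiskerRight (NatTrans.op η.unop) homPrufer)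

/-- The duality functor on functors with values in topological abelian groups:
`(D F)(V) = Hom_cts(F(V^♯), ℤ/2^∞)`. -/
def Dcont : TopFAᵒᵖ ⥤ FA where
  obj F := sharp.rightOp ⋙ F.unop.op ⋙ contHomPrufer
  map η :=
    Functor.whiskerLeft sharp.rightOp (Functor.whiskerRight (NatTrans.op η.unop) contHomPrufer)

/-- An abelian group with its discrete topology. -/
def discrete : AddCommGrpCat.{0} ⥤ TopAb where
  obj A :=
    letI : TopologicalSpace A := ⊥
    haveI : DiscreteTopology A := ⟨rfl⟩
    TopModuleCat.of ℤ A
  map {A B} f :=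
    letI : TopologicalSpace A := ⊥
    haveI : DiscreteTopology A := ⟨rfl⟩
    letI : TopologicalSpace B := ⊥
    haveI : DiscreteTopology B := ⟨rfl⟩
    TopModuleCat.ofHom ⟨f.hom.toIntLinearMap, continuous_of_discreteTopology⟩

/-- On discrete groups, the continuous dual is the group of all homomorphisms. -/
def contHomPruferDiscrete : discrete.op ⋙ contHomPrufer ≅ homPrufer :=
  NatIso.ofComponents
    (fun A => AddEquiv.toAddCommGrpIso
      { toFun := fun φ => φ.toAddMonoidHom
        invFun := fun φ =>
          { toAddMonoidHom := φ
            continuous_toFun := by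
              exact continuous_bot }
        left_inv := fun _ => rfl
        right_inv := fun _ => rfl
        map_add' := fun _ _ => rfl })
    (fun _ => rfl)

/-- Hence the two duality functors agree on functors with values in discrete groups. -/
def DcontDiscrete (F : FA) : Dcont.obj (op (F ⋙ discrete)) ≅ D.obj (op F) :=
  Functor.isoWhiskerLeft (sharp.rightOp ⋙ F.op) contHomPruferDiscrete

/-- The `2`-adic topology on an abelian group: the subgroups `2^k A` form a basis of
neighbourhoods of `0`. -/
abbrev twoAdicTopology (A : Type) [AddCommGroup A] : TopologicalSpace A :=
  (Ideal.span {(2 : ℤ)}).adicModuleTopology A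

theorem twoAdic_isTopologicalAddGroup (A : Type) [AddCommGroup A] :
    @IsTopologicalAddGroup A (twoAdicTopology A) _ :=
  letI : TopologicalSpace ℤ := (Ideal.span {(2 : ℤ)}).adic_basis.topology
  AddGroupFilterBasis.isTopologicalAddGroup
    ((Ideal.span {(2 : ℤ)}).ringFilterBasis.moduleFilterBasis
      ((Ideal.span {(2 : ℤ)}).adic_module_basis A)).toAddGroupFilterBasis

theorem hasBasis_twoAdic (A : Type) [AddCommGroup A] :
    (@nhds A (twoAdicTopology A) 0).HasBasis (fun _ : ℕ => True)
      (fun k => Set.range fun a : A => 2 ^ k • a) := by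
  have key : ∀ k : ℕ, (((Ideal.span {(2 : ℤ)}) ^ k • (⊤ : Submodule ℤ A) : Submodule ℤ A) : Set A)
      = Set.range fun a : A => 2 ^ k • a := by
    intro k
    ext x
    rw [Ideal.span_singleton_pow, Submodule.ideal_span_singleton_smul]
    simp only [SetLike.mem_coe, Submodule.mem_smul_pointwise_iff_exists, Submodule.mem_top,
      true_and, Set.mem_range]
    refine exists_congr fun a => ?_
    rw [← natCast_zsmul]
    norm_num
  let : TopologicalSpace ℤ := (Ideal.span {(2 : ℤ)}).adic_basis.topology
  refine ⟨fun U => ?_⟩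
  refine (AddGroupFilterBasis.nhds_zero_hasBasis
    ((Ideal.span {(2 : ℤ)}).ringFilterBasis.moduleFilterBasis
      ((Ideal.span {(2 : ℤ)}).adic_module_basis A)).toAddGroupFilterBasis).mem_iff.trans ?_
  constructor
  · rintro ⟨W, ⟨k, rfl⟩, hW⟩
    exact ⟨k, trivial, (key k) ▸ hW⟩
  · rintro ⟨k, -, hW⟩
    exact ⟨_, ⟨k, rfl⟩, (key k).symm ▸ hW⟩

theorem twoAdic_continuous {A B : Type} [AddCommGroup A] [AddCommGroup B] (f : A →+ B) :
    @Continuous A B (twoAdicTopology A) (twoAdicTopology B) f := by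
  let : TopologicalSpace A := twoAdicTopology A
  have : IsTopologicalAddGroup A := twoAdic_isTopologicalAddGroup A
  let : TopologicalSpace B := twoAdicTopology B
  have : IsTopologicalAddGroup B := twoAdic_isTopologicalAddGroup B
  refine continuous_of_continuousAt_zero f ?_
  rw [ContinuousAt, map_zero]
  refine ((hasBasis_twoAdic A).tendsto_iff (hasBasis_twoAdic B)).2 fun k _ => ⟨k, trivial, ?_⟩
  rintro _ ⟨a, rfl⟩
  exact ⟨f a, (map_nsmul f (2 ^ k) a).symm⟩

/-- An abelian group with its `2`-adic topology. -/
def twoAdic : AddCommGrpCat.{0} ⥤ TopAb where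
  obj A :=
    letI : TopologicalSpace A := twoAdicTopology A
    haveI : IsTopologicalAddGroup A := twoAdic_isTopologicalAddGroup A
    TopModuleCat.of ℤ A
  map {A B} f :=
    letI : TopologicalSpace A := twoAdicTopology A
    haveI : IsTopologicalAddGroup A := twoAdic_isTopologicalAddGroup A
    letI : TopologicalSpace B := twoAdicTopology B
    haveI : IsTopologicalAddGroup B := twoAdic_isTopologicalAddGroup B
    TopModuleCat.ofHom ⟨f.hom.toIntLinearMap, twoAdic_continuous f.hom⟩

/-! ### The integral group ring and the powers of its augmentation ideal -/

/-- The augmentation `ℤ[V] → ℤ`, which sends `∑ a_v [v]` to `∑ a_v`. -/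
def aug (V : Type) [AddCommGroup V] : AddMonoidAlgebra ℤ V →+* ℤ :=
  (AddMonoidAlgebra.lift ℤ ℤ V 1).toRingHom

/-- The augmentation ideal of `ℤ[V]`. -/
def augIdeal (V : Type) [AddCommGroup V] : Ideal (AddMonoidAlgebra ℤ V) :=
  RingHom.ker (aug V)

/-- The `n`-th power of the augmentation ideal, as a subgroup of the augmentation ideal. For
`n ≥ 1` it is the subgroup generated by the `n`-fold products of elements of the augmentation
ideal, that is, the image of the `n`-fold multiplication map. -/
def augPow (n : ℕ) (V : Type) [AddCommGroup V] : AddSubgroup (augIdeal V) :=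
  (Submodule.comap (augIdeal V).subtype (augIdeal V ^ n)).toAddSubgroup

theorem mem_augPow {n : ℕ} {V : Type} [AddCommGroup V] {x : augIdeal V} :
    x ∈ augPow n V ↔ (x : AddMonoidAlgebra ℤ V) ∈ augIdeal V ^ n := Iff.rfl

/-- The ring homomorphism `ℤ[V] → ℤ[W]` induced by a homomorphism `V → W`. -/
def ringMap {V W : Type} [AddCommGroup V] [AddCommGroup W] (f : V →+ W) :
    AddMonoidAlgebra ℤ V →+* AddMonoidAlgebra ℤ W :=
  AddMonoidAlgebra.mapDomainRingHom ℤ f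

theorem aug_ringMap {V W : Type} [AddCommGroup V] [AddCommGroup W] (f : V →+ W)
    (x : AddMonoidAlgebra ℤ V) : aug W (ringMap f x) = aug V x := by
  have h : (aug W).comp (ringMap f) = aug V := by
    ext <;> simp [aug, ringMap]
  exact congrArg (fun g => g x) h

theorem ringMap_mem {V W : Type} [AddCommGroup V] [AddCommGroup W] (f : V →+ W)
    {x : AddMonoidAlgebra ℤ V} (hx : x ∈ augIdeal V) : ringMap f x ∈ augIdeal W := by
  rw [augIdeal, RingHom.mem_ker] at hx ⊢
  rw [aug_ringMap, hx]

theorem ringMap_mem_pow {V W : Type} [AddCommGroup V] [AddCommGroup W] (f : V →+ W) (n : ℕ)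
    {x : AddMonoidAlgebra ℤ V} (hx : x ∈ augIdeal V ^ n) : ringMap f x ∈ augIdeal W ^ n := by
  have h1 : (augIdeal V).map (ringMap f) ≤ augIdeal W :=
    Ideal.map_le_iff_le_comap.2 fun y hy => ringMap_mem f hy
  have h2 := Ideal.mem_map_of_mem (ringMap f) hx
  rw [Ideal.map_pow] at h2
  exact Ideal.pow_right_mono h1 n h2

/-- The map induced on augmentation ideals. -/
def augMap {V W : Type} [AddCommGroup V] [AddCommGroup W] (f : V →+ W) :
    augIdeal V →+ augIdeal W where
  toFun x := ⟨ringMap f x, ringMap_mem f x.2⟩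
  map_zero' := by ext1; simp
  map_add' x y := by ext1; simp

theorem augMap_id (V : Type) [AddCommGroup V] :
    augMap (AddMonoidHom.id V) = AddMonoidHom.id (augIdeal V) := by
  ext1 x
  apply Subtype.ext
  exact congrArg (fun g => g (x : AddMonoidAlgebra ℤ V))
    (AddMonoidAlgebra.mapDomainRingHom_id (R := ℤ) (M := V))

theorem augMap_comp {U V W : Type} [AddCommGroup U] [AddCommGroup V] [AddCommGroup W]
    (g : V →+ W) (f : U →+ V) : augMap (g.comp f) = (augMap g).comp (augMap f) := by
  ext1 x
  apply Subtype.ext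
  exact congrArg (fun h => h (x : AddMonoidAlgebra ℤ U))
    (AddMonoidAlgebra.mapDomainRingHom_comp (R := ℤ) g f)

theorem augPow_le_comap {V W : Type} [AddCommGroup V] [AddCommGroup W] (f : V →+ W) (n : ℕ) :
    augPow n V ≤ (augPow n W).comap (augMap f) :=
  fun _ hx => ringMap_mem_pow f n hx

/-- The map of additive groups underlying a morphism of vector spaces. -/
def toAdd {V W : Vf} (f : V ⟶ W) : V →+ W := f.hom.hom.toAddMonoidHom

/-- The augmentation ideal functor `P̄_ℤ`. -/
def Pbar : FA where
  obj V := AddCommGrpCat.of (augIdeal V)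
  map f := AddCommGrpCat.ofHom (augMap (toAdd f))
  map_id V := congrArg AddCommGrpCat.ofHom (augMap_id V)
  map_comp f g := congrArg AddCommGrpCat.ofHom (augMap_comp (toAdd g) (toAdd f))

/-- The functor `ℤ₂ ⊗ -` on abelian groups. -/
def tensorZ2 : AddCommGrpCat.{0} ⥤ AddCommGrpCat.{0} where
  obj A := AddCommGrpCat.of (TensorProduct ℤ ℤ_[2] A)
  map f := AddCommGrpCat.ofHom (f.hom.toIntLinearMap.lTensor ℤ_[2]).toAddMonoidHom
  map_id A := by
    ext1
    exact congrArg LinearMap.toAddMonoidHom (LinearMap.lTensor_id ℤ_[2] A)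
  map_comp f g := by
    ext1
    exact congrArg LinearMap.toAddMonoidHom
      (LinearMap.lTensor_comp ℤ_[2] g.hom.toIntLinearMap f.hom.toIntLinearMap)

/-- The `2`-adically completed augmentation ideal functor `P̄_{ℤ₂} = ℤ₂ ⊗ P̄_ℤ`. -/
def PbarZ2 : FA := Pbar ⋙ tensorZ2

/-- `P̄_{ℤ₂}`, each of whose values carries its `2`-adic topology. -/
def PbarZ2Top : TopFA := PbarZ2 ⋙ twoAdic

/-- The functor `R^n = P̄_ℤ / P̄_ℤ^{n+1}`. -/
def R (n : ℕ) : FA where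
  obj V := AddCommGrpCat.of (augIdeal V ⧸ augPow (n + 1) V)
  map f := AddCommGrpCat.ofHom
    (QuotientAddGroup.map _ _ (augMap (toAdd f)) (augPow_le_comap (toAdd f) (n + 1)))
  map_id V := by
    ext1
    refine QuotientAddGroup.addMonoidHom_ext _ (AddMonoidHom.ext fun x => ?_)
    exact congrArg (fun h => (QuotientAddGroup.mk (h x) : augIdeal V ⧸ augPow (n + 1) V))
      (augMap_id V)
  map_comp {U V W} f g := by
    ext1
    refine QuotientAddGroup.addMonoidHom_ext _ (AddMonoidHom.ext fun x => ?_)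
    exact congrArg (fun h => (QuotientAddGroup.mk (h x) : augIdeal W ⧸ augPow (n + 1) W))
      (augMap_comp (toAdd g) (toAdd f))

/-! ### The direct limit of the functors `R^n` -/

theorem two_mul_mem_pow (V : Vf) (n : ℕ) {x : AddMonoidAlgebra ℤ V}
    (hx : x ∈ augIdeal V ^ (n + 1)) : 2 * x ∈ augIdeal V ^ (n + 2) := by
  -- It suffices to treat `n = 0`.
  suffices h : ∀ y ∈ augIdeal V, 2 * y ∈ augIdeal V ^ 2 by
    have h1 : Ideal.span {2} * augIdeal V ≤ augIdeal V ^ 2 := by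
      rw [Ideal.span_singleton_mul_le_iff]
      exact h
    have h2 : Ideal.span {2} * augIdeal V ^ (n + 1) ≤ augIdeal V ^ (n + 2) := by
      calc Ideal.span {2} * augIdeal V ^ (n + 1)
          = (Ideal.span {2} * augIdeal V) * augIdeal V ^ n := by
            rw [pow_succ', mul_assoc]
        _ ≤ augIdeal V ^ 2 * augIdeal V ^ n := Ideal.mul_mono_left h1
        _ = augIdeal V ^ (n + 2) := by rw [← pow_add, add_comm]
    exact h2 (Ideal.mul_mem_mul (Ideal.mem_span_singleton_self _) hx)
  have gen : ∀ v : V, 2 * (AddMonoidAlgebra.single v (1 : ℤ) - 1) ∈ augIdeal V ^ 2 := by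
    intro v
    have hv : AddMonoidAlgebra.single v (1 : ℤ) - 1 ∈ augIdeal V := by
      rw [augIdeal, RingHom.mem_ker]
      simp [aug]
    have hvv : v + v = 0 := by
      rw [← two_smul (ZMod 2) v, show (2 : ZMod 2) = 0 from rfl, zero_smul]
    have hsq : AddMonoidAlgebra.single v (1 : ℤ) * AddMonoidAlgebra.single v (1 : ℤ) = 1 := by
      rw [AddMonoidAlgebra.single_mul_single, hvv, mul_one, AddMonoidAlgebra.one_def]
    have h2 : 2 * (AddMonoidAlgebra.single v (1 : ℤ) - 1) =
        -((AddMonoidAlgebra.single v (1 : ℤ) - 1) * (AddMonoidAlgebra.single v (1 : ℤ) - 1)) := by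
      linear_combination hsq
    rw [h2, pow_two]
    exact neg_mem (Ideal.mul_mem_mul hv hv)
  -- Every `y` is congruent to its augmentation modulo the elements `[v] - [0]`.
  have main : ∀ y : AddMonoidAlgebra ℤ V, 2 * (y - (aug V y : AddMonoidAlgebra ℤ V)) ∈
      augIdeal V ^ 2 := by
    intro y
    induction y using AddMonoidAlgebra.induction_linear with
    | zero => simp
    | add a b ha hb =>
      have : 2 * (a + b - (aug V (a + b) : AddMonoidAlgebra ℤ V)) =
          2 * (a - (aug V a : AddMonoidAlgebra ℤ V)) +
            2 * (b - (aug V b : AddMonoidAlgebra ℤ V)) := by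
        rw [map_add]
        push_cast
        ring
      rw [this]
      exact add_mem ha hb
    | single v c =>
      have h1 : AddMonoidAlgebra.single v c =
          (c : AddMonoidAlgebra ℤ V) * AddMonoidAlgebra.single v (1 : ℤ) := by
        rw [← zsmul_eq_mul, AddMonoidAlgebra.smul_single, smul_eq_mul, mul_one]
      have h2 : aug V (AddMonoidAlgebra.single v c) = c := by simp [aug]
      have h3 : 2 * (AddMonoidAlgebra.single v c - (c : AddMonoidAlgebra ℤ V)) =
          (c : AddMonoidAlgebra ℤ V) * (2 * (AddMonoidAlgebra.single v (1 : ℤ) - 1)) := by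
        rw [h1]
        ring
      rw [h2, h3]
      exact Ideal.mul_mem_left _ _ (gen v)
  intro y hy
  have := main y
  rw [augIdeal, RingHom.mem_ker] at hy
  simpa [hy] using this

/-- Multiplication by `2` on `P̄_ℤ` induces `P̄_ℤ / P̄_ℤ^{n+1} → P̄_ℤ / P̄_ℤ^{n+2}`. -/
def mulTwo (n : ℕ) (V : Vf) :
    (augIdeal V ⧸ augPow (n + 1) V) →+ (augIdeal V ⧸ augPow (n + 2) V) :=
  QuotientAddGroup.map _ _ (nsmulAddMonoidHom 2) fun x hx => by
    have h := two_mul_mem_pow V n (mem_augPow.1 hx)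
    rw [two_mul, ← two_nsmul] at h
    exact h

/-- The morphism `R^n → R^{n+1}` induced by multiplication by `2` on `P̄_ℤ`. -/
def incl (n : ℕ) : R n ⟶ R (n + 1) where
  app V := AddCommGrpCat.ofHom (mulTwo n V)
  naturality V W f := by
    ext1
    refine QuotientAddGroup.addMonoidHom_ext _ (AddMonoidHom.ext fun x => ?_)
    exact congrArg (fun y => (QuotientAddGroup.mk y : augIdeal W ⧸ augPow (n + 2) W))
      (map_nsmul (augMap (toAdd f)) 2 x).symm

/-- `R^∞`, the direct limit of `R^1 → R^2 → R^3 → ⋯`. -/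
def Rinf : FA :=
  Limits.colimit (Functor.ofSequence fun k => incl (k + 1))

end ElemAb

end

/-!
Both isomorphisms come from the dual `D P̄_ℤ : V ↦ Hom(P̄_ℤ(V^♯), ℤ/2^∞)` of the discrete functor
`P̄_ℤ`, which is compared with the three other functors involved.

* `R^∞ ≅ D P̄_ℤ` (`RinfIso`). Elements of `V^♯` are characters of `V` with values in `{1, -1}`, and
  `([v], [χ]) ↦ (-1)^{χ(v)}` extends to a bilinear pairing `ℤ[V] × ℤ[V^♯] → ℤ`. A character maps the
  augmentation ideal into `2ℤ`, hence its `(n+1)`-st power into `2^{n+1}ℤ`, so that dividing the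
  pairing by `2^{n+1}` gives `R^n → D P̄_ℤ`; doubling in the source is absorbed by the
  denominator, and a morphism `R^∞ → D P̄_ℤ` results. That it is bijective is Fourier inversion
  with good control of the powers of the ideal: if `v_1, …, v_d` is a basis of `V` on which
  `χ ≠ 0` is constantly `1`, then the product of the `1 - [v_i]` lies in the `d`-th power, its
  value at the character `χ` is `2^d`, and its value at all other characters is `0`
  (`exists_character_eq_delta`). Together with the injectivity of the Fourier transform
  (`eq_zero_of_character_eq_zero`) this gives surjectivity (`exists_pairing_eq`) and shows that the
  kernel of the pairing on `R^n` is killed by `R^n → R^{n+d}` (`exists_pow_nsmul_mem_augPow`).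
* `D P̄_{ℤ₂} ≅ D P̄_ℤ` (`DcontPbarZ2TopIso`). For a finitely generated group `A`, continuous
  homomorphisms `ℤ₂ ⊗ A → ℤ/2^∞` restrict bijectively to homomorphisms `A → ℤ/2^∞`
  (`contRestrict_bijective`).
* `P̄_{ℤ₂} ≅ D D P̄_ℤ` (`PbarZ2Iso`). This is biduality for free abelian groups of finite rank
  (`toDoubleDual_bijective`); it rests on the fact that every endomorphism of `ℤ/2^∞` is
  multiplication by a `2`-adic integer (`Prufer.exists_eq_smul`).
-/

noncomputable section

namespace ElemAb

/-! ### The Prüfer group as a module over the 2-adic integers -/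

namespace Prufer

/-- The projection `ℚ₂ → ℚ₂/ℤ₂`. -/
def mk : ℚ_[2] →+ Prufer := QuotientAddGroup.mk' (PadicInt.subring 2).toAddSubgroup

theorem mk_surjective : Function.Surjective mk := QuotientAddGroup.mk'_surjective _

theorem mk_eq_zero {q : ℚ_[2]} : mk q = 0 ↔ ‖q‖ ≤ 1 :=
  QuotientAddGroup.eq_zero_iff (N := (PadicInt.subring 2).toAddSubgroup) q

theorem mk_coe (z : ℤ_[2]) : mk z = 0 := mk_eq_zero.2 z.2

theorem exists_coe_of_mk_eq_zero {q : ℚ_[2]} (h : mk q = 0) : ∃ z : ℤ_[2], (z : ℚ_[2]) = q :=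
  ⟨⟨q, mk_eq_zero.1 h⟩, rfl⟩

/-- Multiplication by a `2`-adic integer on `ℚ₂/ℤ₂`. -/
def mul (z : ℤ_[2]) : Prufer →+ Prufer :=
  QuotientAddGroup.map (PadicInt.subring 2).toAddSubgroup (PadicInt.subring 2).toAddSubgroup
    (AddMonoidHom.mulLeft (z : ℚ_[2])) fun _ hx => (PadicInt.subring 2).mul_mem z.2 hx

theorem mul_mk (z : ℤ_[2]) (q : ℚ_[2]) : mul z (mk q) = mk (z * q) := rfl

instance : Module ℤ_[2] Prufer where
  smul z p := mul z p
  one_smul p := by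
    obtain ⟨q, rfl⟩ := mk_surjective p
    exact (mul_mk 1 q).trans (by simp)
  mul_smul y z p := by
    obtain ⟨q, rfl⟩ := mk_surjective p
    exact (mul_mk (y * z) q).trans (by simp [mul_assoc, HSMul.hSMul, mul_mk])
  smul_zero z := map_zero (mul z)
  smul_add z := map_add (mul z)
  add_smul y z p := by
    obtain ⟨q, rfl⟩ := mk_surjective p
    exact (mul_mk (y + z) q).trans (by simp [add_mul, HSMul.hSMul, mul_mk])
  zero_smul p := by
    obtain ⟨q, rfl⟩ := mk_surjective p
    exact (mul_mk 0 q).trans (by simp)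

theorem smul_mk (z : ℤ_[2]) (q : ℚ_[2]) : z • mk q = mk (z * q) := rfl

theorem coe_two_pow (k : ℕ) : (((2 : ℤ_[2]) ^ k : ℤ_[2]) : ℚ_[2]) = 2 ^ k :=
  PadicInt.coe_pow 2 k

/-- The class of `1 / 2^k`. -/
def gen (k : ℕ) : Prufer := mk ((2 ^ k)⁻¹)

theorem two_nsmul_gen (k : ℕ) : 2 • gen (k + 1) = gen k := by
  rw [gen, gen, ← map_nsmul]
  congr 1
  rw [pow_succ, nsmul_eq_mul, mul_inv]
  push_cast
  field_simp

theorem pow_zsmul_gen (k m : ℕ) : (2 ^ m : ℤ) • gen (k + m) = gen k := by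
  induction m with
  | zero => simp
  | succ m ih =>
    rw [← ih, pow_succ, mul_smul, ← add_assoc, ← two_nsmul_gen (k + m), ← natCast_zsmul]
    rfl

theorem smul_gen_eq_zero {k : ℕ} {z : ℤ_[2]} : z • gen k = 0 ↔ (2 : ℤ_[2]) ^ k ∣ z := by
  rw [gen, smul_mk]
  constructor
  · intro h
    obtain ⟨y, hy⟩ := exists_coe_of_mk_eq_zero h
    refine ⟨y, Subtype.ext ?_⟩
    rw [PadicInt.coe_mul, coe_two_pow, hy]
    field_simp
  · rintro ⟨y, rfl⟩
    rw [← mk_coe y]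
    congr 1
    rw [PadicInt.coe_mul, coe_two_pow]
    field_simp

theorem zsmul_gen_eq_zero {k : ℕ} {c : ℤ} : c • gen k = 0 ↔ (2 : ℤ) ^ k ∣ c := by
  rw [← Int.cast_smul_eq_zsmul ℤ_[2], smul_gen_eq_zero]
  have := PadicInt.pow_p_dvd_int_iff (p := 2) k c
  exact_mod_cast this

/-- Every element of `ℚ₂/ℤ₂` is an integral multiple of some `1 / 2^k`. -/
theorem exists_eq_zsmul_gen (p : Prufer) : ∃ (k : ℕ) (c : ℤ), p = c • gen k := by
  obtain ⟨q, rfl⟩ := mk_surjective p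
  obtain ⟨k, hk⟩ : ∃ k : ℕ, ‖(2 : ℚ_[2]) ^ k * q‖ ≤ 1 := by
    obtain ⟨k, hk⟩ := pow_unbounded_of_one_lt ‖q‖ (one_lt_two (α := ℝ))
    refine ⟨k, ?_⟩
    have h2 : ‖(2 : ℚ_[2])‖ = 2⁻¹ := by exact_mod_cast Padic.norm_p (p := 2)
    rw [norm_mul, norm_pow, h2, inv_pow, inv_mul_le_iff₀ (by positivity), mul_one]
    exact hk.le
  let z : ℤ_[2] := ⟨_, hk⟩
  refine ⟨k, z.appr k, ?_⟩
  have h1 : mk q = z • gen k := by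
    rw [gen, smul_mk]
    congr 1
    change q = 2 ^ k * q * (2 ^ k)⁻¹
    field_simp
  have h2 : (z - z.appr k) • gen k = 0 := by
    rw [smul_gen_eq_zero]
    exact_mod_cast Ideal.mem_span_singleton.1 (PadicInt.appr_spec k z)
  rw [sub_smul, sub_eq_zero] at h2
  rw [h1, h2, natCast_zsmul, Nat.cast_smul_eq_nsmul]

theorem exists_eq_zsmul_gen_of_finite {ι : Type*} [Finite ι] (p : ι → Prufer) (m : ℕ) :
    ∃ k ≥ m, ∃ c : ι → ℤ, ∀ i, p i = c i • gen k := by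
  cases nonempty_fintype ι
  choose k c h using fun i => exists_eq_zsmul_gen (p i)
  refine ⟨Finset.univ.sup k + m, by omega, fun i => c i * 2 ^ (Finset.univ.sup k + m - k i),
    fun i => ?_⟩
  have hi : k i ≤ Finset.univ.sup k := Finset.le_sup (Finset.mem_univ i)
  have h1 := pow_zsmul_gen (k i) (Finset.univ.sup k + m - k i)
  rw [Nat.add_sub_cancel' (by omega)] at h1
  rw [mul_smul, h1, h i]

theorem eq_zero_of_smul_eq_zero {z : ℤ_[2]} (h : ∀ p : Prufer, z • p = 0) : z = 0 := by
  by_contra hz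
  have h1 := smul_gen_eq_zero.1 (h (gen (z.valuation + 1)))
  have h2 := (PadicInt.mem_span_pow_iff_le_valuation z hz (z.valuation + 1)).1
    (Ideal.mem_span_singleton.2 (by exact_mod_cast h1))
  omega

/-- The endomorphisms of `ℚ₂/ℤ₂` are the multiplications by `2`-adic integers: on the classes of
`1 / 2^k` an endomorphism is multiplication by integers that converge `2`-adically. -/
theorem exists_eq_smul (f : Prufer →+ Prufer) : ∃ z : ℤ_[2], ∀ p, f p = z • p := by
  have h1 : ∀ k, ∃ c : ℤ_[2], f (gen k) = c • gen k := by
    intro k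
    obtain ⟨q, hq⟩ := mk_surjective (f (gen k))
    have h2 : mk (2 ^ k * q) = 0 := by
      have : (2 ^ k * q : ℚ_[2]) = 2 ^ k • q := by rw [nsmul_eq_mul]; push_cast; rfl
      rw [this, map_nsmul, hq, ← map_nsmul, ← natCast_zsmul, zsmul_gen_eq_zero.2 (by simp),
        map_zero]
    obtain ⟨c, hc⟩ := exists_coe_of_mk_eq_zero h2
    refine ⟨c, ?_⟩
    rw [← hq, gen, smul_mk, hc]
    congr 1
    field_simp
  choose c hc using h1
  have hcoh : ∀ {m n : ℕ}, m ≤ n → (2 : ℤ_[2]) ^ m ∣ c m - c n := by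
    intro m n hmn
    obtain ⟨d, rfl⟩ := Nat.exists_eq_add_of_le hmn
    rw [← smul_gen_eq_zero, sub_smul, ← hc, sub_eq_zero]
    conv_rhs => rw [← pow_zsmul_gen m d, smul_comm, ← hc, ← map_zsmul]
    rw [pow_zsmul_gen]
  have hmax : ∀ n, (IsLocalRing.maximalIdeal ℤ_[2] ^ n • ⊤ : Submodule ℤ_[2] ℤ_[2]) =
      Ideal.span {(2 : ℤ_[2]) ^ n} := by
    intro n
    rw [PadicInt.maximalIdeal_eq_span_p, Ideal.span_singleton_pow]
    simp
  obtain ⟨z, hz⟩ := IsPrecomplete.prec (I := IsLocalRing.maximalIdeal ℤ_[2]) (M := ℤ_[2])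
    inferInstance (f := c) (fun {m n} hmn => by
      rw [SModEq.sub_mem, hmax, Ideal.mem_span_singleton]
      exact hcoh hmn)
  refine ⟨z, fun p => ?_⟩
  obtain ⟨k, b, rfl⟩ := exists_eq_zsmul_gen p
  have h3 := hz k
  rw [SModEq.sub_mem, hmax, Ideal.mem_span_singleton, ← smul_gen_eq_zero, sub_smul,
    sub_eq_zero] at h3
  rw [map_zsmul, hc, h3, smul_comm]

end Prufer

/-! ### Characters of the group ring and powers of the augmentation ideal -/

section Characters

variable {V : Type} [AddCommGroup V]

theorem single_sub_one_mem (v : V) : AddMonoidAlgebra.single v (1 : ℤ) - 1 ∈ augIdeal V := by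
  rw [augIdeal, RingHom.mem_ker]
  simp [aug]

/-- The generator `[v] - [0]` of the augmentation ideal. -/
def augGen (v : V) : augIdeal V := ⟨AddMonoidAlgebra.single v 1 - 1, single_sub_one_mem v⟩

theorem closure_augGen : AddSubgroup.closure (Set.range (augGen (V := V))) = ⊤ := by
  have main : ∀ x : AddMonoidAlgebra ℤ V, x - (aug V x : AddMonoidAlgebra ℤ V) ∈
      (AddSubgroup.closure (Set.range (augGen (V := V)))).map
        (augIdeal V).subtype.toAddMonoidHom := by
    intro x
    induction x using AddMonoidAlgebra.induction_linear with
    | zero => simp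
    | add a b ha hb =>
      have : a + b - (aug V (a + b) : AddMonoidAlgebra ℤ V) =
          (a - (aug V a : AddMonoidAlgebra ℤ V)) + (b - (aug V b : AddMonoidAlgebra ℤ V)) := by
        rw [map_add]
        push_cast
        ring
      rw [this]
      exact add_mem ha hb
    | single v c =>
      refine ⟨c • augGen v, zsmul_mem (AddSubgroup.subset_closure (Set.mem_range_self v)) c, ?_⟩
      have h2 : aug V (AddMonoidAlgebra.single v c) = c := by simp [aug]
      rw [h2]
      change c • (AddMonoidAlgebra.single v (1 : ℤ) - 1) = _
      rw [smul_sub, AddMonoidAlgebra.smul_single, smul_eq_mul, mul_one, zsmul_one]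
  rw [eq_top_iff]
  intro x _
  obtain ⟨y, hy, hyx⟩ := main x
  have hx : aug V x = 0 := x.2
  rw [hx, Int.cast_zero, sub_zero] at hyx
  rwa [← show y = x from Subtype.ext hyx]

theorem augIdeal_addHom_ext {A : Type*} [AddCommGroup A] {f g : augIdeal V →+ A}
    (h : ∀ v, f (augGen v) = g (augGen v)) : f = g :=
  AddMonoidHom.eq_of_eqOn_dense closure_augGen (by rintro _ ⟨v, rfl⟩; exact h v)

theorem augMap_augGen {W : Type} [AddCommGroup W] (f : V →+ W) (v : V) :
    augMap f (augGen v) = augGen (f v) := by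
  apply Subtype.ext
  change ringMap f (AddMonoidAlgebra.single v 1 - 1) = _
  rw [map_sub, map_one]
  simp [ringMap, augGen]

variable [Module (ZMod 2) V]

/-- The sign character `a ↦ (-1)^a` of `𝔽₂`. -/
def sign : Multiplicative (ZMod 2) →* ℤ where
  toFun a := if a.toAdd = 0 then 1 else -1
  map_one' := rfl
  map_mul' := by decide

/-- The character of `V` with values in `{1, -1}` attached to a linear form `χ`, extended to a
ring homomorphism `ℤ[V] → ℤ`. -/
def character (χ : Module.Dual (ZMod 2) V) : AddMonoidAlgebra ℤ V →+* ℤ :=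
  (AddMonoidAlgebra.lift ℤ ℤ V (sign.comp χ.toAddMonoidHom.toMultiplicative)).toRingHom

theorem character_single (χ : Module.Dual (ZMod 2) V) (v : V) (c : ℤ) :
    character χ (AddMonoidAlgebra.single v c) = c * if χ v = 0 then 1 else -1 := by
  simp [character, sign]

theorem character_zero : character (0 : Module.Dual (ZMod 2) V) = aug V := by
  ext <;> simp [character_single, aug]

theorem character_ringMap {W : Type} [AddCommGroup W] [Module (ZMod 2) W] (f : V →ₗ[ZMod 2] W)
    (χ : Module.Dual (ZMod 2) W) (x : AddMonoidAlgebra ℤ V) :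
    character χ (ringMap f.toAddMonoidHom x) = character (f.dualMap χ) x := by
  have h : (character χ).comp (ringMap f.toAddMonoidHom) = character (f.dualMap χ) := by
    refine RingHom.ext fun y => ?_
    induction y using AddMonoidAlgebra.induction_linear with
    | zero => simp
    | add a b ha hb => rw [map_add, map_add, ha, hb]
    | single v c =>
      rw [RingHom.comp_apply, character_single]
      exact (congrArg _ AddMonoidAlgebra.mapDomain_single).trans (character_single _ _ _)
  exact congrArg (fun g => g x) h

theorem two_dvd_character (χ : Module.Dual (ZMod 2) V) {x : AddMonoidAlgebra ℤ V}
    (hx : x ∈ augIdeal V) : 2 ∣ character χ x := by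
  have h : ∀ x : augIdeal V, 2 ∣ character χ x := by
    intro x
    have hx : x ∈ AddSubgroup.closure (Set.range (augGen (V := V))) := by
      rw [closure_augGen]; trivial
    induction hx using AddSubgroup.closure_induction with
    | mem x hx =>
      obtain ⟨v, rfl⟩ := hx
      rw [augGen, map_sub, map_one, character_single]
      split <;> norm_num
    | zero => simp
    | add x y _ _ hx hy => simpa using dvd_add hx hy
    | neg x _ hx => simpa using hx
  exact h ⟨x, hx⟩

theorem pow_dvd_character (χ : Module.Dual (ZMod 2) V) {n : ℕ} {x : AddMonoidAlgebra ℤ V}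
    (hx : x ∈ augIdeal V ^ n) : 2 ^ n ∣ character χ x := by
  have h1 : (augIdeal V).map (character χ) ≤ Ideal.span {2} :=
    Ideal.map_le_iff_le_comap.2 fun y hy => Ideal.mem_span_singleton.2 (two_dvd_character χ hy)
  have h2 := Ideal.mem_map_of_mem (character χ) hx
  rw [Ideal.map_pow] at h2
  have h3 := Ideal.pow_right_mono h1 n h2
  rwa [Ideal.span_singleton_pow, Ideal.mem_span_singleton] at h3

/-- An element of `ℤ[V]` is determined by its characters. This is the linear independence of the
characters of the dual group `V^♯` attached to the elements of `V`. -/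
theorem eq_zero_of_character_eq_zero {x : AddMonoidAlgebra ℤ V} (h : ∀ χ, character χ x = 0) :
    x = 0 := by
  let Φ : V → (Multiplicative (Module.Dual (ZMod 2) V) →* ℤ) := fun v =>
    sign.comp (Module.Dual.eval (ZMod 2) V v).toAddMonoidHom.toMultiplicative
  have hΦ : ∀ v χ, Φ v (Multiplicative.ofAdd χ) = if χ v = 0 then 1 else -1 := fun _ _ => rfl
  have hinj : Function.Injective Φ := by
    intro v w hvw
    rw [← sub_eq_zero, ← Module.forall_dual_apply_eq_zero_iff (ZMod 2)]
    intro χ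
    have h1 := congrArg (fun f => f (Multiplicative.ofAdd χ)) hvw
    simp only [hΦ] at h1
    have h2 : ∀ a b : ZMod 2, ((if a = 0 then 1 else -1 : ℤ) = if b = 0 then 1 else -1) →
        a - b = 0 := by decide
    rw [map_sub]
    exact h2 _ _ h1
  have hli := (linearIndependent_monoidHom (Multiplicative (Module.Dual (ZMod 2) V)) ℤ).comp Φ hinj
  have h0 : Finsupp.linearCombination ℤ (fun v => ⇑(Φ v)) x.coeff = 0 := by
    ext χ
    have h1 := h χ.toAdd
    have h2 : ∀ y : AddMonoidAlgebra ℤ V, character χ.toAdd y =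
        Finsupp.linearCombination ℤ (fun v => ⇑(Φ v)) y.coeff χ := by
      intro y
      induction y using AddMonoidAlgebra.induction_linear with
      | zero => simp
      | add a b ha hb => simp [ha, hb]
      | single v c =>
        rw [character_single]
        simp only [AddMonoidAlgebra.coeff_single, Finsupp.linearCombination_single, Pi.smul_apply,
          smul_eq_mul]
        rfl
    rw [← h2, h1]
    rfl
  have := linearIndependent_iff.1 hli _ h0
  exact AddMonoidAlgebra.coeff_injective (by simpa using this)

variable [Module.Finite (ZMod 2) V]

/-- The function on `V^♯` supported at a point `χ ≠ 0` with value `2^d`, where `d = dim V`, is the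
Fourier transform of an element of the `d`-th power of the augmentation ideal: the product of the
elements `1 - [v]` where `v` runs through a basis of `V` on which `χ` is constantly `1`. -/
theorem exists_character_eq_delta {χ : Module.Dual (ZMod 2) V} (hχ : χ ≠ 0) :
    ∃ w ∈ augIdeal V ^ Module.finrank (ZMod 2) V,
      character χ w = 2 ^ Module.finrank (ZMod 2) V ∧ ∀ ψ, ψ ≠ χ → character ψ w = 0 := by
  classical
  let b := Module.finBasis (ZMod 2) V
  obtain ⟨j, hj⟩ : ∃ j, χ (b j) = 1 := by
    by_contra! hne
    refine hχ (b.ext fun i => ?_)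
    have h01 : ∀ a : ZMod 2, a ≠ 1 → a = 0 := by decide
    simpa using h01 _ (hne i)
  let v : Fin (Module.finrank (ZMod 2) V) → V := fun i => if χ (b i) = 1 then b i else b i + b j
  have hv : ∀ i, χ (v i) = 1 := by
    intro i
    by_cases hi : χ (b i) = 1
    · simp [v, hi]
    · have h01 : ∀ a : ZMod 2, a ≠ 1 → a = 0 := by decide
      simp [v, h01 _ hi, hj]
  have hdet : ∀ ψ : Module.Dual (ZMod 2) V, (∀ i, ψ (v i) = 1) → ψ = χ := by
    intro ψ hψ
    have hψj : ψ (b j) = 1 := by simpa [v, hj] using hψ j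
    refine b.ext fun i => ?_
    have h1 := (hψ i).trans (hv i).symm
    by_cases hi : χ (b i) = 1
    · simpa [v, hi] using h1
    · simpa [v, hi, hψj, hj] using h1
  have hfac : ∀ (ψ : Module.Dual (ZMod 2) V) i,
      character ψ (1 - AddMonoidAlgebra.single (v i) 1) = if ψ (v i) = 1 then 2 else 0 := by
    intro ψ i
    have h01 : ∀ a : ZMod 2, (1 - 1 * (if a = 0 then 1 else -1) : ℤ) = if a = 1 then 2 else 0 := by
      decide
    rw [map_sub, map_one, character_single, h01]
  refine ⟨∏ i, (1 - AddMonoidAlgebra.single (v i) 1), ?_, ?_, fun ψ hψ => ?_⟩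
  · have := Ideal.prod_mem_prod (s := Finset.univ) (I := fun _ => augIdeal V)
      (x := fun i => 1 - AddMonoidAlgebra.single (v i) (1 : ℤ))
      (fun i _ => by rw [← neg_sub]; exact neg_mem (single_sub_one_mem (v i)))
    simpa using this
  · rw [map_prod, Finset.prod_congr rfl fun i _ => (hfac χ i).trans (if_pos (hv i))]
    simp
  · obtain ⟨i, hi⟩ : ∃ i, ψ (v i) ≠ 1 := by
      by_contra! hall
      exact hψ (hdet ψ hall)
    rw [map_prod]
    exact Finset.prod_eq_zero (Finset.mem_univ i) ((hfac ψ i).trans (if_neg hi))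

/-- Every integral function on `V^♯` that vanishes at `0` becomes, after multiplication by `2^d`,
where `d = dim V`, the Fourier transform of an element of the `d`-th power of the augmentation
ideal. -/
theorem exists_character_eq (u : Module.Dual (ZMod 2) V → ℤ) (hu : u 0 = 0) :
    ∃ w ∈ augIdeal V ^ Module.finrank (ZMod 2) V,
      ∀ χ, character χ w = u χ * 2 ^ Module.finrank (ZMod 2) V := by
  classical
  have : Finite (Module.Dual (ZMod 2) V) := Module.finite_of_finite (ZMod 2)
  cases nonempty_fintype (Module.Dual (ZMod 2) V)
  have h1 : ∀ χ : Module.Dual (ZMod 2) V, ∃ w ∈ augIdeal V ^ Module.finrank (ZMod 2) V,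
      ∀ ψ, character ψ w = if ψ = χ then u χ * 2 ^ Module.finrank (ZMod 2) V else 0 := by
    intro χ
    by_cases hχ : χ = 0
    · exact ⟨0, zero_mem _, by simp [hχ, hu]⟩
    · obtain ⟨w, hw, h2, h3⟩ := exists_character_eq_delta hχ
      refine ⟨u χ * w, Ideal.mul_mem_left _ _ hw, fun ψ => ?_⟩
      rw [map_mul, map_intCast]
      split
      · next h => rw [h, h2]; rfl
      · next h => rw [h3 ψ h, mul_zero]
  choose w hw h2 using h1
  refine ⟨∑ χ, w χ, sum_mem fun χ _ => hw χ, fun χ => ?_⟩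
  rw [map_sum, Finset.sum_congr rfl fun ψ _ => h2 ψ χ]
  simp

/-- If all characters of an element `x` of the augmentation ideal are divisible by `2^n`, then
`x` lies in the `n`-th power of the augmentation ideal up to a shift by `d = dim V`: Fourier
inversion writes `2^d x` as `2^n` times an element of the `d`-th power. -/
theorem pow_mul_mem_pow {n : ℕ} {x : AddMonoidAlgebra ℤ V} (hx : x ∈ augIdeal V)
    (h : ∀ χ, 2 ^ n ∣ character χ x) :
    ∃ y ∈ augIdeal V ^ Module.finrank (ZMod 2) V,
      2 ^ Module.finrank (ZMod 2) V * x = 2 ^ n * y := by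
  choose u hu using h
  have hu0 : u 0 = 0 := by
    have h1 := hu 0
    rw [character_zero, show aug V x = 0 from hx] at h1
    have : (2 ^ n : ℤ) ≠ 0 := by positivity
    simpa [this] using h1.symm
  obtain ⟨y, hy, h2⟩ := exists_character_eq u hu0
  refine ⟨y, hy, sub_eq_zero.1 (eq_zero_of_character_eq_zero fun χ => ?_)⟩
  rw [map_sub, map_mul, map_mul, h2, hu, map_pow, map_pow, map_ofNat]
  ring

end Characters

/-! ### Duality for finitely generated abelian groups -/

section Duality

variable (A : Type) [AddCommGroup A]

open TensorProduct

/-- The homomorphism `A → ℤ₂ ⊗ A`, `a ↦ 1 ⊗ a`. -/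
def oneTmul : A →+ ℤ_[2] ⊗[ℤ] A := (TensorProduct.mk ℤ ℤ_[2] A 1).toAddMonoidHom

/-- The homomorphism underlying a `2`-adically continuous one. -/
def forgetCont : contHomPrufer.obj (op (twoAdic.obj (AddCommGrpCat.of A))) →+ (A →+ Prufer) where
  toFun φ := @ContinuousAddMonoidHom.toAddMonoidHom A Prufer _ _ (twoAdicTopology A) _ φ
  map_zero' := rfl
  map_add' _ _ := rfl

/-- Restriction of continuous homomorphisms along `A → ℤ₂ ⊗ A`. -/
def contRestrict : contHomPrufer.obj (op (twoAdic.obj (AddCommGrpCat.of (ℤ_[2] ⊗[ℤ] A)))) →+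
    (A →+ Prufer) :=
  (AddMonoidHom.compHom' (oneTmul A)).comp (forgetCont (ℤ_[2] ⊗[ℤ] A))

variable {A}

/-- A homomorphism into the Prüfer group is continuous for the `2`-adic topology if and only if
it kills some `2^k A`. -/
theorem continuous_twoAdic_iff {f : A →+ Prufer} :
    @Continuous A Prufer (twoAdicTopology A) _ f ↔ ∃ k : ℕ, ∀ a, f (2 ^ k • a) = 0 := by
  let : TopologicalSpace A := twoAdicTopology A
  have : IsTopologicalAddGroup A := twoAdic_isTopologicalAddGroup A
  constructor
  · intro hf
    have h1 : f ⁻¹' {0} ∈ nhds (0 : A) :=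
      hf.continuousAt.preimage_mem_nhds (by rw [map_zero]; exact (isOpen_discrete _).mem_nhds rfl)
    obtain ⟨k, -, hk⟩ := (hasBasis_twoAdic A).mem_iff.1 h1
    exact ⟨k, fun a => hk ⟨a, rfl⟩⟩
  · rintro ⟨k, hk⟩
    refine continuous_of_continuousAt_zero f ?_
    rw [ContinuousAt, map_zero, nhds_discrete Prufer, Filter.tendsto_pure]
    refine Filter.mem_of_superset ((hasBasis_twoAdic A).mem_of_mem (i := k) trivial) ?_
    rintro _ ⟨a, rfl⟩
    exact hk a

theorem forgetCont_injective : Function.Injective (forgetCont A) := by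
  intro φ ψ h
  exact @ContinuousAddMonoidHom.ext A Prufer _ _ (twoAdicTopology A) _ φ ψ
    fun a => congrArg (fun f : A →+ Prufer => f a) h

theorem mem_range_forgetCont {f : A →+ Prufer} :
    f ∈ (forgetCont A).range ↔ ∃ k : ℕ, ∀ a, f (2 ^ k • a) = 0 := by
  rw [← continuous_twoAdic_iff]
  constructor
  · rintro ⟨φ, rfl⟩
    exact @ContinuousAddMonoidHom.continuous_toFun A Prufer _ _ (twoAdicTopology A) _ φ
  · intro hf
    exact ⟨@ContinuousAddMonoidHom.mk A Prufer _ _ (twoAdicTopology A) _ f hf, rfl⟩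

/-- A homomorphism from a finitely generated group to the Prüfer group is
killed by a power of `2`. -/
theorem exists_pow_smul_eq_zero [Module.Finite ℤ A] (f : A →+ Prufer) :
    ∃ k : ℕ, ∀ a, 2 ^ k • f a = 0 := by
  obtain ⟨n, s, hs⟩ := Module.Finite.exists_fin (R := ℤ) (M := A)
  obtain ⟨k, -, c, hc⟩ := Prufer.exists_eq_zsmul_gen_of_finite (fun i => f (s i)) 0
  refine ⟨k, fun a => ?_⟩
  have ha : a ∈ Submodule.span ℤ (Set.range s) := by rw [hs]; trivial
  induction ha using Submodule.span_induction with
  | mem x hx =>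
    obtain ⟨i, rfl⟩ := hx
    rw [hc i, smul_comm, ← natCast_zsmul, Prufer.zsmul_gen_eq_zero.2 (by simp), smul_zero]
  | zero => simp
  | add x y _ _ hx hy => rw [map_add, smul_add, hx, hy, add_zero]
  | smul m x _ hx => rw [map_zsmul, smul_comm, hx, smul_zero]

/-- The `ℤ₂`-linear extension `ℤ₂ ⊗ A → ℚ₂/ℤ₂` of a homomorphism `A → ℚ₂/ℤ₂`. -/
def extend (f : A →+ Prufer) : ℤ_[2] ⊗[ℤ] A →+ Prufer :=
  TensorProduct.liftAddHom
    { toFun := fun z => (DistribSMul.toAddMonoidHom Prufer z).comp f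
      map_zero' := by ext; simp
      map_add' := fun y z => by ext; simp [add_smul] }
    fun n z a => by
      change (n • z) • f a = z • f (n • a)
      rw [map_zsmul, smul_assoc, smul_comm]

theorem extend_tmul (f : A →+ Prufer) (z : ℤ_[2]) (a : A) : extend f (z ⊗ₜ a) = z • f a := rfl

theorem extend_lTensor {B : Type} [AddCommGroup B] (g : A →+ B) (f : B →+ Prufer)
    (t : ℤ_[2] ⊗[ℤ] A) :
    extend f (g.toIntLinearMap.lTensor ℤ_[2] t) = extend (f.comp g) t := by
  induction t using TensorProduct.induction_on with
  | zero => simp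
  | add x y hx hy => rw [map_add, map_add, map_add, hx, hy]
  | tmul z a => rfl

theorem contRestrict_bijective [Module.Finite ℤ A] : Function.Bijective (contRestrict A) := by
  constructor
  · rw [injective_iff_map_eq_zero]
    intro φ hφ
    obtain ⟨k, hk⟩ := mem_range_forgetCont.1 ⟨φ, rfl⟩
    refine (injective_iff_map_eq_zero _).1 forgetCont_injective φ (AddMonoidHom.ext fun t => ?_)
    set φ' : ℤ_[2] ⊗[ℤ] A →+ Prufer := forgetCont (ℤ_[2] ⊗[ℤ] A) φ
    have h0 : ∀ a, φ' (1 ⊗ₜ a) = 0 := fun a => congrArg (fun f : A →+ Prufer => f a) hφ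
    rw [AddMonoidHom.zero_apply]
    induction t using TensorProduct.induction_on with
    | zero => exact map_zero φ'
    | add x y hx hy => rw [map_add, hx, hy, add_zero]
    | tmul z a =>
      -- `z` is an integer up to a multiple of `2^k`.
      obtain ⟨y, hy⟩ := Ideal.mem_span_singleton.1 (PadicInt.appr_spec k z)
      have hz : z = z.appr k • (1 : ℤ_[2]) + 2 ^ k • y := by
        rw [nsmul_one, nsmul_eq_mul, ← sub_eq_iff_eq_add', hy]
        push_cast
        rfl
      rw [hz, TensorProduct.add_tmul, map_add, ← TensorProduct.smul_tmul',
        ← TensorProduct.smul_tmul', map_nsmul, h0, hk, smul_zero, add_zero]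
  · intro f
    obtain ⟨k, hk⟩ := exists_pow_smul_eq_zero f
    obtain ⟨φ, hφ⟩ : extend f ∈ (forgetCont (ℤ_[2] ⊗[ℤ] A)).range := by
      refine mem_range_forgetCont.2 ⟨k, fun t => ?_⟩
      rw [map_nsmul]
      induction t using TensorProduct.induction_on with
      | zero => simp
      | add x y hx hy => rw [map_add, smul_add, hx, hy, add_zero]
      | tmul z a => rw [extend_tmul, smul_comm, hk, smul_zero]
    refine ⟨φ, AddMonoidHom.ext fun a => ?_⟩
    exact (congrArg (fun g => g (1 ⊗ₜ a)) hφ).trans (one_smul ℤ_[2] (f a))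

variable (A) in
/-- The evaluation homomorphism from `ℤ₂ ⊗ A` to the double dual of `A`. -/
def toDoubleDual : ℤ_[2] ⊗[ℤ] A →+ ((A →+ Prufer) →+ Prufer) where
  toFun t :=
    { toFun := fun f => extend f t
      map_zero' := by
        induction t using TensorProduct.induction_on with
        | zero => simp
        | add x y hx hy => rw [map_add, hx, hy, add_zero]
        | tmul z a => simp [extend_tmul]
      map_add' := fun f g => by
        induction t using TensorProduct.induction_on with
        | zero => simp
        | add x y hx hy => rw [map_add, map_add, map_add, hx, hy]; abel
        | tmul z a => simp [extend_tmul] }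
  map_zero' := AddMonoidHom.ext fun f => map_zero (extend f)
  map_add' x y := AddMonoidHom.ext fun f => map_add (extend f) x y

theorem toDoubleDual_apply (t : ℤ_[2] ⊗[ℤ] A) (f : A →+ Prufer) :
    toDoubleDual A t f = extend f t := rfl

/-- Biduality for a free abelian group of finite rank. On coordinates it is the identification of
`ℤ₂` with the endomorphism ring of the Prüfer group. -/
theorem toDoubleDual_bijective [Module.Finite ℤ A] [Module.Free ℤ A] :
    Function.Bijective (toDoubleDual A) := by
  classical
  let b := Module.Free.chooseBasis ℤ A
  -- The homomorphisms `A → ℚ₂/ℤ₂` that factor through a coordinate.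
  let coord : Module.Free.ChooseBasisIndex ℤ A → Prufer →+ (A →+ Prufer) := fun i =>
    { toFun := fun p => (zmultiplesHom Prufer p).comp (b.coord i).toAddMonoidHom
      map_zero' := by ext; simp
      map_add' := fun p q => by ext; simp }
  have hcoord : ∀ i p a, coord i p a = b.repr a i • p := fun _ _ _ => rfl
  have hsum : ∀ f : A →+ Prufer, f = ∑ i, coord i (f (b i)) := by
    intro f
    ext a
    rw [AddMonoidHom.finsetSum_apply]
    conv_lhs => rw [← b.sum_repr a, map_sum]
    exact Finset.sum_congr rfl fun i _ => by rw [map_zsmul, hcoord]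
  have hrep : ∀ t : ℤ_[2] ⊗[ℤ] A, ∃ z : Module.Free.ChooseBasisIndex ℤ A → ℤ_[2],
      t = ∑ i, z i ⊗ₜ b i := by
    intro t
    induction t using TensorProduct.induction_on with
    | zero => exact ⟨0, by simp⟩
    | add x y hx hy =>
      obtain ⟨z, rfl⟩ := hx
      obtain ⟨w, rfl⟩ := hy
      exact ⟨z + w, by simp [TensorProduct.add_tmul, Finset.sum_add_distrib]⟩
    | tmul z a =>
      refine ⟨fun i => b.repr a i • z, ?_⟩
      conv_lhs => rw [← b.sum_repr a, TensorProduct.tmul_sum]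
      exact Finset.sum_congr rfl fun i _ => (TensorProduct.smul_tmul _ _ _).symm
  have heval : ∀ (z : Module.Free.ChooseBasisIndex ℤ A → ℤ_[2]) (i) (p : Prufer),
      toDoubleDual A (∑ j, z j ⊗ₜ b j) (coord i p) = z i • p := by
    intro z i p
    rw [toDoubleDual_apply, map_sum, Finset.sum_eq_single i]
    · simp [extend_tmul, hcoord]
    · intro j _ hj
      simp [extend_tmul, hcoord, Finsupp.single_eq_of_ne hj.symm]
    · simp
  constructor
  · rw [injective_iff_map_eq_zero]
    intro t ht
    obtain ⟨z, rfl⟩ := hrep t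
    refine Finset.sum_eq_zero fun i _ => ?_
    rw [Prufer.eq_zero_of_smul_eq_zero (z := z i) fun p => ?_, TensorProduct.zero_tmul]
    rw [← heval z i p, ht]
    rfl
  · intro F
    choose z hz using fun i => Prufer.exists_eq_smul (F.comp (coord i))
    refine ⟨∑ j, z j ⊗ₜ b j, AddMonoidHom.ext fun f => ?_⟩
    rw [hsum f, map_sum F, map_sum (toDoubleDual A _)]
    exact Finset.sum_congr rfl fun i _ => (heval z i _).trans (hz i _).symm

end Duality

/-! ### The pairing between the quotients `R^n(V)` and the dual of `P̄_ℤ(V^♯)` -/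

section Pairing

variable {V : Type} [AddCommGroup V] [Module (ZMod 2) V]

/-- The pairing `ℤ[V] × ℤ[V^♯] → ℤ` with `([v], [χ]) ↦ (-1)^{χ(v)}`, restricted to augmentation
ideals, multiplied by `1 / 2^{n+1}` and reduced modulo `ℤ₂`. -/
def pairing (n : ℕ) : augIdeal V →+ (augIdeal (Module.Dual (ZMod 2) V) →+ Prufer) where
  toFun x := (((zmultiplesHom Prufer (Prufer.gen (n + 1))).comp
    (Finsupp.linearCombination ℤ fun χ => character χ x.1).toAddMonoidHom).comp
      AddMonoidAlgebra.coeffAddEquiv.toAddMonoidHom).comp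
        (augIdeal (Module.Dual (ZMod 2) V)).subtype.toAddMonoidHom
  map_zero' := augIdeal_addHom_ext fun χ => by simp [augGen, AddMonoidAlgebra.one_def]
  map_add' x y := augIdeal_addHom_ext fun χ => by
    simp only [augGen, AddMonoidAlgebra.one_def]
    simp
    module

theorem pairing_augGen (n : ℕ) (x : augIdeal V) (χ : Module.Dual (ZMod 2) V) :
    pairing n x (augGen χ) = character χ x.1 • Prufer.gen (n + 1) := by
  have hx : character 0 x.1 = 0 := by rw [character_zero]; exact x.2
  simp [pairing, augGen, AddMonoidAlgebra.one_def, hx]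

theorem pairing_eq_zero_iff {n : ℕ} {x : augIdeal V} :
    pairing n x = 0 ↔ ∀ χ, 2 ^ (n + 1) ∣ character χ x.1 := by
  constructor
  · intro h χ
    rw [← Prufer.zsmul_gen_eq_zero, ← pairing_augGen, h, AddMonoidHom.zero_apply]
  · intro h
    exact augIdeal_addHom_ext fun χ => by
      rw [pairing_augGen, Prufer.zsmul_gen_eq_zero.2 (h χ), AddMonoidHom.zero_apply]

theorem pairing_succ_two_nsmul (n : ℕ) (x : augIdeal V) :
    pairing (n + 1) (2 • x) = pairing n x := by
  refine augIdeal_addHom_ext fun χ => ?_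
  rw [map_nsmul, AddMonoidHom.nsmul_apply, pairing_augGen, pairing_augGen, smul_comm,
    Prufer.two_nsmul_gen]

theorem pairing_augMap {W : Type} [AddCommGroup W] [Module (ZMod 2) W] (f : V →ₗ[ZMod 2] W)
    (n : ℕ) (x : augIdeal V) :
    pairing n (augMap f.toAddMonoidHom x) =
      (pairing n x).comp (augMap f.dualMap.toAddMonoidHom) := by
  refine augIdeal_addHom_ext fun χ => ?_
  rw [AddMonoidHom.comp_apply, augMap_augGen, pairing_augGen]
  exact (congrArg (· • _) (character_ringMap f χ x.1)).trans (pairing_augGen n x _).symm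

/-- The homomorphism `P̄_ℤ(V) / P̄_ℤ(V)^{n+1} → Hom(P̄_ℤ(V^♯), ℤ/2^∞)` given by the pairing. -/
def pairingQuot (n : ℕ) :
    augIdeal V ⧸ augPow (n + 1) V →+ (augIdeal (Module.Dual (ZMod 2) V) →+ Prufer) :=
  QuotientAddGroup.lift _ (pairing n) fun _ hx =>
    pairing_eq_zero_iff.2 fun χ => pow_dvd_character χ (mem_augPow.1 hx)

variable [Module.Finite (ZMod 2) V]

theorem two_pow_mul_mem_pow {n : ℕ} {x : AddMonoidAlgebra ℤ V} (hx : x ∈ augIdeal V ^ (n + 1))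
    (k : ℕ) : 2 ^ k * x ∈ augIdeal V ^ (n + k + 1) := by
  induction k with
  | zero => simpa using hx
  | succ k ih =>
    rw [pow_succ' 2, mul_assoc]
    exact two_mul_mem_pow (FGModuleCat.of (ZMod 2) V) (n + k) ih

/-- The kernel of the pairing on `R^n(V)` dies in the direct limit of the `R^n(V)`. -/
theorem exists_pow_nsmul_mem_augPow {n : ℕ} {x : augIdeal V} (h : pairing n x = 0) :
    ∃ d : ℕ, 2 ^ d • x ∈ augPow (n + d + 1) V := by
  have hdvd := pairing_eq_zero_iff.1 h
  obtain ⟨y, hy, hxy⟩ := pow_mul_mem_pow x.2 hdvd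
  -- For `V = 0` the ideal `augIdeal V ^ 0` carries no information, but then `x = 0`.
  rcases hd : Module.finrank (ZMod 2) V with _ | d
  · have : Subsingleton V := Module.finrank_zero_iff.1 hd
    have hx : x = 0 := Subtype.ext <| eq_zero_of_character_eq_zero fun χ => by
      rw [Subsingleton.elim χ 0, character_zero]
      exact x.2
    exact ⟨0, by rw [hx, smul_zero]; exact zero_mem _⟩
  · refine ⟨d + 1, mem_augPow.2 ?_⟩
    rw [hd] at hy hxy
    have h1 : ((2 ^ (d + 1) • x : augIdeal V) : AddMonoidAlgebra ℤ V) = 2 ^ (n + 1) * y := by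
      rw [← hxy, Submodule.coe_smul_of_tower, nsmul_eq_mul]
      push_cast
      rfl
    rw [h1, show n + (d + 1) + 1 = d + (n + 1) + 1 by omega]
    exact two_pow_mul_mem_pow hy (n + 1)

/-- Every homomorphism `P̄_ℤ(V^♯) → ℤ/2^∞` comes from some `R^n(V)`. -/
theorem exists_pairing_eq (φ : augIdeal (Module.Dual (ZMod 2) V) →+ Prufer) :
    ∃ n ≥ 1, ∃ x : augIdeal V, pairing n x = φ := by
  classical
  have : Finite (Module.Dual (ZMod 2) V) := Module.finite_of_finite (ZMod 2)
  obtain ⟨k, hk, c, hc⟩ := Prufer.exists_eq_zsmul_gen_of_finite (fun χ => φ (augGen χ)) 2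
  -- The value at `0` may be normalised because `augGen 0 = 0`.
  have h0 : augGen (0 : Module.Dual (ZMod 2) V) = 0 := Subtype.ext (sub_self _)
  obtain ⟨w, -, hw⟩ := exists_character_eq (Function.update c 0 0) (Function.update_self ..)
  have hw0 : aug V w = 0 := by rw [← character_zero, hw]; simp
  refine ⟨k + Module.finrank (ZMod 2) V - 1, by omega, ⟨w, hw0⟩, augIdeal_addHom_ext fun χ => ?_⟩
  rw [pairing_augGen, hw, show k + Module.finrank (ZMod 2) V - 1 + 1 =
    k + Module.finrank (ZMod 2) V by omega, mul_smul, Prufer.pow_zsmul_gen]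
  by_cases hχ : χ = 0
  · simp [hχ, h0]
  · rw [Function.update_of_ne hχ]
    exact (hc χ).symm

end Pairing

/-! ### The natural isomorphisms -/

theorem finite_dual (V : Vf) : Finite (Module.Dual (ZMod 2) V) :=
  Module.finite_of_finite (ZMod 2)

/-- The continuous dual of `P̄_{ℤ₂}` is the dual of the discrete functor `P̄_ℤ`. -/
def DcontPbarZ2TopIso : Dcont.obj (op PbarZ2Top) ≅ D.obj (op Pbar) :=
  NatIso.ofComponents
    (fun V =>
      haveI := finite_dual V
      (AddEquiv.ofBijective (contRestrict (augIdeal (Module.Dual (ZMod 2) V)))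
        contRestrict_bijective).toAddCommGrpIso)
    fun _ => rfl

/-- The morphism `R^n → D P̄_ℤ` given by the pairing. -/
def RToD (n : ℕ) : R n ⟶ D.obj (op Pbar) where
  app V := AddCommGrpCat.ofHom (pairingQuot (V := V) n)
  naturality V W f := by
    ext1
    refine QuotientAddGroup.addMonoidHom_ext _ (AddMonoidHom.ext fun x => ?_)
    exact pairing_augMap f.hom.hom n x

theorem incl_comp_RToD (n : ℕ) : incl n ≫ RToD (n + 1) = RToD n := by
  ext V : 2
  ext1
  refine QuotientAddGroup.addMonoidHom_ext _ (AddMonoidHom.ext fun x => ?_)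
  exact pairing_succ_two_nsmul n x

/-- The compatible family of the morphisms `R^n → D P̄_ℤ`. -/
def RCocone : Limits.Cocone (Functor.ofSequence fun k => incl (k + 1)) where
  pt := D.obj (op Pbar)
  ι := NatTrans.ofSequence (fun k => RToD (k + 1)) fun k => by
    rw [Functor.ofSequence_map_homOfLE_succ]
    exact (incl_comp_RToD (k + 1)).trans (Category.comp_id _).symm

/-- The morphism `R^∞ → D P̄_ℤ` given by the pairing. -/
def RinfToD : Rinf ⟶ D.obj (op Pbar) := Limits.colimit.desc _ RCocone

/-- The structure morphism `R^{k+1} → R^∞` of the direct limit. -/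
def RinfOf (k : ℕ) : R (k + 1) ⟶ Rinf :=
  Limits.colimit.ι (Functor.ofSequence fun k => incl (k + 1)) k

theorem RinfOf_comp_RinfToD (k : ℕ) : RinfOf k ≫ RinfToD = RToD (k + 1) :=
  Limits.colimit.ι_desc RCocone k

theorem incl_comp_RinfOf (k : ℕ) : incl (k + 1) ≫ RinfOf (k + 1) = RinfOf k := by
  have h := Limits.colimit.w (Functor.ofSequence fun k => incl (k + 1)) (homOfLE (Nat.le_succ k))
  rwa [Functor.ofSequence_map_homOfLE_succ] at h

theorem RinfOf_app_mk (V : Vf) (k d : ℕ) (x : augIdeal V) :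
    ((RinfOf (k + d)).app V).hom (QuotientAddGroup.mk (2 ^ d • x)) =
      ((RinfOf k).app V).hom (QuotientAddGroup.mk x) := by
  induction d with
  | zero => rw [pow_zero, one_smul]; rfl
  | succ d ih =>
    rw [← ih, ← incl_comp_RinfOf (k + d), pow_succ', mul_smul]
    rfl

theorem exists_RinfOf_app_mk (V : Vf) (z : Rinf.obj V) :
    ∃ (k : ℕ) (x : augIdeal V), ((RinfOf k).app V).hom (QuotientAddGroup.mk x) = z := by
  obtain ⟨k, y, hy⟩ := Limits.Concrete.isColimit_exists_rep _
    (Limits.isColimitOfPreserves ((evaluation Vf AddCommGrpCat.{0}).obj V)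
      (Limits.colimit.isColimit (Functor.ofSequence fun k => incl (k + 1)))) z
  obtain ⟨x, rfl⟩ := QuotientAddGroup.mk_surjective (s := augPow (k + 1 + 1) V) y
  exact ⟨k, x, hy⟩

theorem RinfToD_app_mk (V : Vf) (k : ℕ) (x : augIdeal V) :
    (RinfToD.app V).hom (((RinfOf k).app V).hom (QuotientAddGroup.mk x)) = pairing (k + 1) x :=
  congrArg (fun η : R (k + 1) ⟶ D.obj (op Pbar) => (η.app V).hom (QuotientAddGroup.mk x))
    (RinfOf_comp_RinfToD k)

theorem RinfToD_app_bijective (V : Vf) : Function.Bijective (RinfToD.app V).hom := by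
  constructor
  · rw [injective_iff_map_eq_zero]
    intro z hz
    obtain ⟨k, x, rfl⟩ := exists_RinfOf_app_mk V z
    obtain ⟨d, hd⟩ := exists_pow_nsmul_mem_augPow ((RinfToD_app_mk V k x).symm.trans hz)
    rw [← RinfOf_app_mk V k d x, (QuotientAddGroup.eq_zero_iff (N := augPow (k + d + 1 + 1) V) _).2
      (by rwa [show k + d + 1 + 1 = k + 1 + d + 1 by omega])]
    exact map_zero _
  · intro φ
    obtain ⟨n, hn, x, hx⟩ := exists_pairing_eq (V := V) φ
    obtain ⟨k, rfl⟩ := Nat.exists_eq_add_of_le' hn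
    exact ⟨_, (RinfToD_app_mk V k x).trans hx⟩

/-- The direct limit of the `R^n` is the dual of `P̄_ℤ`. -/
def RinfIso : Rinf ≅ D.obj (op Pbar) :=
  NatIso.ofComponents
    (fun V => (AddEquiv.ofBijective _ (RinfToD_app_bijective V)).toAddCommGrpIso)
    fun f => RinfToD.naturality f

/-- The canonical isomorphism of a finite-dimensional vector space with its double dual. -/
def evalIso (V : Vf) : V ≅ sharp.obj (op (sharp.obj (op V))) :=
  (Module.evalEquiv (ZMod 2) V).toFGModuleCatIso

theorem evalIso_naturality {V W : Vf} (f : V ⟶ W) :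
    f ≫ (evalIso W).hom = (evalIso V).hom ≫ sharp.map (sharp.map f.op).op := rfl

/-- `P̄_{ℤ₂}` is the double dual of `P̄_ℤ`. -/
def PbarZ2Iso : PbarZ2 ≅ D.obj (op (D.obj (op Pbar))) :=
  NatIso.ofComponents
    (fun V => PbarZ2.mapIso (evalIso V) ≪≫
      haveI : Finite (sharp.obj (op (sharp.obj (op V)))) := finite_dual (sharp.obj (op V))
      (AddEquiv.ofBijective (toDoubleDual (augIdeal (sharp.obj (op (sharp.obj (op V))))))
        toDoubleDual_bijective).toAddCommGrpIso)
    fun {V W} f => by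
      have h1 : PbarZ2.map f ≫ PbarZ2.map (evalIso W).hom =
          PbarZ2.map (evalIso V).hom ≫ PbarZ2.map (sharp.map (sharp.map f.op).op) := by
        rw [← Functor.map_comp, evalIso_naturality, Functor.map_comp]
      ext1
      refine AddMonoidHom.ext fun t => AddMonoidHom.ext fun φ => ?_
      have h2 := congrArg (fun g => extend φ (g.hom t)) h1
      exact h2.trans (extend_lTensor _ φ _)

end ElemAb

end

theorem mainTheorem6 :
    Nonempty (ElemAb.Rinf ≅ ElemAb.Dcont.obj (Opposite.op ElemAb.PbarZ2Top)) ∧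
      Nonempty (ElemAb.PbarZ2 ≅ ElemAb.D.obj (Opposite.op ElemAb.Rinf)) :=
  ⟨⟨ElemAb.RinfIso ≪≫ ElemAb.DcontPbarZ2TopIso.symm⟩,
    ⟨ElemAb.PbarZ2Iso ≪≫ ElemAb.D.mapIso ElemAb.RinfIso.op⟩⟩
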